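/- For an integer $v\ge 1$ let $K_v$ be the complete graph with vertex set $\{0,1,\dots,v-1\}$. The length of the edge joining $i$ and $j$ is $\min(|j-i|,\,v-|j-i|)$, and its linear length is $|j-i|$. A multiset $L$ of size $v-1$ is realizable if it is the multiset of the lengths of the edges of some Hamiltonian path of $K_v$, and it has a linear realization if it is the multiset of the linear lengths of the edges of some Hamiltonian path of $K_v$. Call $L$ strongly admissible (for $v$) if it has size $v-1$, its elements lie in $\{1,\dots,\lfloor v/2\rfloor\}$, for each divisor $d$ of $v$ at most $v-d$ elements of $L$ are multiples of $d$, and every element of $L$ is coprime to $v$ (which makes the divisor condition automatic). The Coprime BHR Conjecture says that every strongly admissible multiset is realizable. Write $\{1^a,x^b,y^c\}$ for the multiset containing $1$, $x$, $y$ with multiplicities $a,b,c\ge 0$. Let $1<x<y\le \lfloor v/2\rfloor$ with $\gcd(v,x)=\gcd(v,y)=1$. For a residue $g$ modulo $v$, represented in $\{0,\dots,v-1\}$, put $\widehat g=\min(g,v-g)$. With inverses and products taken modulo $v$, let $\dot x$ and $\dot y$ be the minimum and the maximum of $\widehat{x^{-1}y}$ and $\widehat{x^{-1}}$, and let $\ddot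 x$ and $\ddot y$ be the minimum and the maximum of $\widehat{y^{-1}}$ and $\widehat{xy^{-1}}$. Define $$f(x,y)=\begin{cases} y-1 & \text{if $x$ and $y$ are even},\\ x+y-2 & \text{if $x=3$, or if $x$ is even and $y$ is odd},\\ x+y-1 & \text{otherwise.}\end{cases}$$ Theorem. Let $L=\{1^a,x^b,y^c\}$ be strongly admissible for $v$, with $v,x,y$ as above. 1. If $a\ge f(x,y)$, $b\ge f(\dot x,\dot y)$ or $c\ge f(\ddot x,\ddot y)$, then $L$ is realizable. 2. Hence, if $L$ is a counterexample to the Coprime BHR Conjecture (that is, if $L$ is not realizable), then $f(x,y)+f(\dot x,\dot y)+f(\ddot x,\ddot y)\ge v+2$. Moreover, for all integers $1<x<y$ and $a,b,c\ge 0$ (with no admissibility assumption), the multiset $\{1^a,x^b,y^c\}$ has a linear realization, on $a+b+c+1$ vertices, if $a\ge x+y-1$; and also if $a\ge x+y-2$ and either $x=3$ or $x$ is even. -/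

import Mathlib

/-- The (cyclic) length `min (|j - i|, v - |j - i|)` of the edge joining the vertices `i` and `j`
of the complete graph on `{0, 1, …, v - 1}`. -/
def cyclicLength {v : ℕ} (i j : Fin v) : ℕ :=
  min ((j : ℤ) - (i : ℤ)).natAbs (v - ((j : ℤ) - (i : ℤ)).natAbs)

/-- The linear length `|j - i|` of the edge joining the vertices `i` and `j`. -/
def linearLength {v : ℕ} (i j : Fin v) : ℕ := ((j : ℤ) - (i : ℤ)).natAbs

theorem cyclicLength_comm {v : ℕ} (i j : Fin v) : cyclicLength i j = cyclicLength j i := by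
  unfold cyclicLength
  rw [← Int.natAbs_neg, neg_sub]

theorem linearLength_comm {v : ℕ} (i j : Fin v) : linearLength i j = linearLength j i := by
  unfold linearLength
  rw [← Int.natAbs_neg, neg_sub]

/-- The cyclic length as a labelling of unordered pairs of vertices. -/
def edgeCyclicLength {v : ℕ} : Sym2 (Fin v) → ℕ :=
  Sym2.lift ⟨cyclicLength, cyclicLength_comm⟩

/-- The linear length as a labelling of unordered pairs of vertices. -/
def edgeLinearLength {v : ℕ} : Sym2 (Fin v) → ℕ :=
  Sym2.lift ⟨linearLength, linearLength_comm⟩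

/-- `L` is realizable (for `v` vertices): some Hamiltonian path of `K_v` has `L` as its multiset
of cyclic edge lengths. -/
def Realizable (v : ℕ) (L : Multiset ℕ) : Prop :=
  ∃ (s t : Fin v) (p : (⊤ : SimpleGraph (Fin v)).Walk s t),
    p.IsHamiltonian ∧ ((p.edges.map edgeCyclicLength : List ℕ) : Multiset ℕ) = L

/-- `L` has a linear realization (on `v` vertices): some Hamiltonian path of `K_v` has `L` as its
multiset of linear edge lengths. -/
def LinearlyRealizable (v : ℕ) (L : Multiset ℕ) : Prop :=
  ∃ (s t : Fin v) (p : (⊤ : SimpleGraph (Fin v)).Walk s t),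
    p.IsHamiltonian ∧ ((p.edges.map edgeLinearLength : List ℕ) : Multiset ℕ) = L

/-- `L` meets the conditions of the Buratti–Horak–Rosa conjecture for `v` vertices: it has size
`v - 1`, its support lies in `{1, …, ⌊v/2⌋}`, and for every divisor `d` of `v` it contains at most
`v - d` multiples of `d`. -/
def Admissible (v : ℕ) (L : Multiset ℕ) : Prop :=
  L.card + 1 = v ∧ (∀ z ∈ L, 1 ≤ z ∧ z ≤ v / 2) ∧
    ∀ d : ℕ, d ∣ v → L.countP (fun z => d ∣ z) ≤ v - d

/-- `L` meets moreover the condition of the coprime Buratti–Horak–Rosa conjecture: all its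
elements are coprime to `v`. -/
def StronglyAdmissible (v : ℕ) (L : Multiset ℕ) : Prop :=
  Admissible v L ∧ ∀ z ∈ L, Nat.gcd v z = 1

/-- The multiset `{1^a, x^b, y^c}`. -/
def oneXY (x y a b c : ℕ) : Multiset ℕ :=
  Multiset.replicate a 1 + Multiset.replicate b x + Multiset.replicate c y

/-- The reduced form `min (g, v - g)` of a residue `g` modulo `v`, where `g` is represented in
`{0, 1, …, v - 1}`. -/
def reducedForm (v : ℕ) (g : ZMod v) : ℕ := min g.val (v - g.val)

/-- The smaller of the two elements other than `1` in the support of `x⁻¹ · {1, x, y}`. -/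
def dotX (v x y : ℕ) : ℕ :=
  min (reducedForm v ((x : ZMod v)⁻¹ * (y : ZMod v))) (reducedForm v (x : ZMod v)⁻¹)

/-- The larger of the two elements other than `1` in the support of `x⁻¹ · {1, x, y}`. -/
def dotY (v x y : ℕ) : ℕ :=
  max (reducedForm v ((x : ZMod v)⁻¹ * (y : ZMod v))) (reducedForm v (x : ZMod v)⁻¹)

/-- The smaller of the two elements other than `1` in the support of `y⁻¹ · {1, x, y}`. -/
def ddotX (v x y : ℕ) : ℕ :=
  min (reducedForm v (y : ZMod v)⁻¹) (reducedForm v ((x : ZMod v) * (y : ZMod v)⁻¹))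

/-- The larger of the two elements other than `1` in the support of `y⁻¹ · {1, x, y}`. -/
def ddotY (v x y : ℕ) : ℕ :=
  max (reducedForm v (y : ZMod v)⁻¹) (reducedForm v ((x : ZMod v) * (y : ZMod v)⁻¹))

/-- The bound `f(x, y)`. It is only used for `1 < x < y`, so the subtractions are not truncated. -/
def boundF (x y : ℕ) : ℕ :=
  if Even x ∧ Even y then y - 1
  else if x = 3 ∨ (Even x ∧ Odd y) then x + y - 2
  else x + y - 1

/-! Modulo `v` a length is a residue up to sign, so multiplying the vertices by a unit carries
Hamiltonian paths to Hamiltonian paths and scales all lengths. Dividing by `x` or `y` makes `b` or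
`c` the multiplicity of 1, so the bounds on `b` and `c` follow from the bound on `a`. For that one a
linear realization suffices, since linear lengths up to `v / 2` are cyclic lengths.

Two paths starting at 0 can be glued at that endpoint once one of them is reflected
(`Standard.add`), so lengths `x` and `y` are treated in separate halves. Each half grows from a seed
made of a few runs of consecutive numbers: a step from `p` to `p + 1` becomes the detour `p, p + y,
p + y + 1, p + 1`, which adds two edges `y` and keeps the number of 1s (`PathOn.pairInsert`). For
odd `y` the start of the path picks up the vertex that the pairs leave over in each row
(`PathOn.oddRows`). With `y - 1` ones this leaves only the case of odd `y` with `c` modulo `y` odd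
and at least 3 (`standard_or_exceptional`). There one more 1, or one edge `x` borrowed from the
other half, repairs the parity (`standard_odd_extra`, `standard_mixed`).

The halves together need `x + y - 1` ones, and one fewer if `x` is even or 3, when the `x` half is
never exceptional. If `x` and `y` are both even, a single path can be extended by both lengths, and
`y - 1` ones suffice (`linearPath_of_both_even`). -/

/-! ### Distances and links in lists -/

/-- The distance of two natural numbers. -/
def gap (a b : ℕ) : ℕ := (a - b) + (b - a)

theorem gap_comm (a b : ℕ) : gap a b = gap b a := by unfold gap; omega

/-- The multiset of distances of consecutive entries of a list. -/
def gaps : List ℕ → Multiset ℕ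
  | [] => 0
  | [_] => 0
  | a :: b :: t => gap a b ::ₘ gaps (b :: t)

/-- The numbers `p` and `p + 1` are consecutive entries of the list, in either order. -/
def Linked (p : ℕ) : List ℕ → Prop
  | [] => False
  | [_] => False
  | a :: b :: t => (a = p ∧ b = p + 1 ∨ a = p + 1 ∧ b = p) ∨ Linked p (b :: t)

/-- The pivot `a` is kept in both pieces, so that each edge is counted exactly once. -/
theorem gaps_append (u : List ℕ) (a : ℕ) (v : List ℕ) :
    gaps (u ++ a :: v) = gaps (u ++ [a]) + gaps (a :: v) := by
  induction u with
  | nil => simp [gaps]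
  | cons x u ih =>
    cases u with
    | nil => simp [gaps]
    | cons y u => simpa [gaps] using ih

theorem linked_append (p : ℕ) (u : List ℕ) (a : ℕ) (v : List ℕ) :
    Linked p (u ++ a :: v) ↔ Linked p (u ++ [a]) ∨ Linked p (a :: v) := by
  induction u with
  | nil => simp [Linked]
  | cons x u ih =>
    cases u with
    | nil => simp [Linked]
    | cons y u =>
      simp only [List.cons_append, Linked] at ih ⊢
      rw [ih]; tauto

theorem gaps_reverse (l : List ℕ) : gaps l.reverse = gaps l := by
  induction l with
  | nil => rfl
  | cons a t ih =>
    cases t with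
    | nil => rfl
    | cons b t =>
      have h := gaps_append t.reverse b [a]
      simp only [List.reverse_cons, List.append_assoc, List.cons_append, List.nil_append] at ih h ⊢
      rw [h, ih]
      simp only [gaps, gap_comm b a]
      rw [add_comm, Multiset.cons_add, zero_add]

theorem linked_reverse (p : ℕ) (l : List ℕ) : Linked p l.reverse ↔ Linked p l := by
  induction l with
  | nil => rfl
  | cons a t ih =>
    cases t with
    | nil => rfl
    | cons b t =>
      have h := linked_append p t.reverse b [a]
      simp only [List.reverse_cons, List.append_assoc, List.cons_append, List.nil_append] at ih h ⊢
      rw [h, ih]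
      simp only [Linked]
      tauto

theorem Linked.exists_append {p : ℕ} {l : List ℕ} (h : Linked p l) :
    ∃ u v, l = u ++ p :: (p + 1) :: v ∨ l = u ++ (p + 1) :: p :: v := by
  induction l with
  | nil => exact h.elim
  | cons a t ih =>
    cases t with
    | nil => exact h.elim
    | cons b t =>
      rcases h with (⟨rfl, rfl⟩ | ⟨rfl, rfl⟩) | h
      · exact ⟨[], t, Or.inl rfl⟩
      · exact ⟨[], t, Or.inr rfl⟩
      · obtain ⟨u, v, h | h⟩ := ih h
        · exact ⟨a :: u, v, Or.inl (by rw [h]; rfl)⟩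
        · exact ⟨a :: u, v, Or.inr (by rw [h]; rfl)⟩

theorem gaps_map {f : ℕ → ℕ} {l : List ℕ}
    (hf : ∀ a ∈ l, ∀ b ∈ l, gap (f a) (f b) = gap a b) : gaps (l.map f) = gaps l := by
  induction l with
  | nil => rfl
  | cons a t ih =>
    cases t with
    | nil => rfl
    | cons b t =>
      have := ih fun x hx y hy => hf x (List.mem_cons_of_mem _ hx) y (List.mem_cons_of_mem _ hy)
      simp only [List.map_cons, gaps] at this ⊢
      rw [this, hf a (by simp) b (by simp)]

theorem card_gaps (a : ℕ) (t : List ℕ) : (gaps (a :: t)).card = t.length := by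
  induction t generalizing a with
  | nil => rfl
  | cons b t ih => simp [gaps, ih]

/-! ### Routes and their concatenation -/

/-- `Route V M s e E`: the vertices in `V` can be listed without repetition from `s` to `e`, with
multiset of distances of consecutive entries `M`, in such a way that for each `p` in `E` the
vertices `p` and `p + 1` are consecutive. -/
def Route (V : Set ℕ) (M : Multiset ℕ) (s e : ℕ) (E : Set ℕ) : Prop :=
  ∃ l : List ℕ, l.Nodup ∧ (∀ v, v ∈ l ↔ v ∈ V) ∧ gaps l = M ∧ l.head? = some s ∧
    l.getLast? = some e ∧ ∀ p ∈ E, Linked p l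

theorem Route.congr {V V' : Set ℕ} {M M' : Multiset ℕ} {s s' e e' : ℕ} {E E' : Set ℕ}
    (h : Route V M s e E) (hV : ∀ v, v ∈ V' ↔ v ∈ V) (hM : M' = M) (hs : s' = s) (he : e' = e)
    (hE : ∀ p ∈ E', p ∈ E) : Route V' M' s' e' E' := by
  subst hM hs he
  obtain ⟨l, h1, h2, h3, h4, h5, h6⟩ := h
  exact ⟨l, h1, fun v => by rw [h2, hV], h3, h4, h5, fun p hp => h6 p (hE p hp)⟩

theorem Route.reverse {V : Set ℕ} {M : Multiset ℕ} {s e : ℕ} {E : Set ℕ}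
    (h : Route V M s e E) : Route V M e s E := by
  obtain ⟨l, h1, h2, h3, h4, h5, h6⟩ := h
  exact ⟨l.reverse, by simpa using h1, by simpa using h2, by rw [gaps_reverse, h3],
    by simpa using h5, by simpa using h4, fun p hp => (linked_reverse p l).2 (h6 p hp)⟩

theorem Route.append {V V' : Set ℕ} {M M' : Multiset ℕ} {s s' e e' : ℕ} {E E' : Set ℕ}
    (h : Route V M s e E) (h' : Route V' M' s' e' E') (hd : ∀ v, v ∈ V → v ∉ V') :
    Route (V ∪ V') (M + M' + {gap e s'}) s e' (E ∪ E') := by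
  obtain ⟨l, h1, h2, h3, h4, h5, h6⟩ := h
  obtain ⟨l', h1', h2', h3', h4', h5', h6'⟩ := h'
  obtain ⟨u, rfl⟩ : ∃ u, l = u ++ [e] := by
    have := List.getLast?_eq_some_iff.1 h5
    exact this
  obtain ⟨w, rfl⟩ : ∃ w, l' = s' :: w := List.head?_eq_some_iff.1 h4'
  refine ⟨u ++ [e] ++ s' :: w, ?_, ?_, ?_, ?_, ?_, ?_⟩
  · rw [List.nodup_append]
    refine ⟨h1, h1', fun a ha b hb hab => ?_⟩
    subst hab
    exact hd a ((h2 a).1 ha) ((h2' a).1 hb)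
  · intro v
    rw [List.mem_append, h2, h2', Set.mem_union]
  · rw [List.append_assoc, List.singleton_append, gaps_append, h3]
    simp only [gaps]
    rw [h3', ← Multiset.singleton_add]
    abel
  · rw [List.head?_append, h4]; rfl
  · rw [List.getLast?_append, h5']; rfl
  · intro p hp
    rw [List.append_assoc, List.singleton_append, linked_append]
    rcases hp with hp | hp
    · exact Or.inl (h6 p hp)
    · exact Or.inr (Or.inr (h6' p hp))

theorem route_singleton (a : ℕ) : Route {a} 0 a a ∅ :=
  ⟨[a], by simp, by simp, rfl, rfl, rfl, by simp⟩

/-- The increasing run from `a` to `b`. -/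
theorem route_up {a b : ℕ} (hab : a ≤ b) :
    Route (Set.Icc a b) ((b - a) • {1}) a b (Set.Ico a b) := by
  induction b, hab using Nat.le_induction with
  | base => exact (route_singleton a).congr (by simp) (by simp) rfl rfl (by simp)
  | succ b hb ih =>
    obtain ⟨l, h1, h2, h3, h4, h5, h6⟩ := ih
    obtain ⟨u, rfl⟩ : ∃ u, l = u ++ [b] := List.getLast?_eq_some_iff.1 h5
    refine ⟨u ++ b :: [b + 1], ?_, ?_, ?_, ?_, ?_, ?_⟩
    · have : u ++ b :: [b + 1] = (u ++ [b]) ++ [b + 1] := by simp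
      rw [this, List.nodup_append]
      refine ⟨h1, by simp, fun x hx y hy hxy => ?_⟩
      have h := (h2 x).1 hx
      simp only [List.mem_singleton] at hy
      simp only [Set.mem_Icc] at h
      omega
    · intro v
      have := h2 v
      simp only [List.mem_append, List.mem_cons, List.not_mem_nil, or_false, Set.mem_Icc] at this ⊢
      rw [← or_assoc, this]
      omega
    · rw [gaps_append, h3]
      have : b + 1 - a = (b - a) + 1 := by omega
      rw [this, add_smul, one_smul]
      simp [gaps, gap]
    · have : u ++ b :: [b + 1] = (u ++ [b]) ++ [b + 1] := by simp
      rw [this, List.head?_append, h4]; rfl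
    · simp
    · intro p hp
      rw [linked_append]
      simp only [Set.mem_Ico] at hp
      rcases Nat.lt_or_ge p b with h | h
      · exact Or.inl (h6 p ⟨hp.1, h⟩)
      · have : p = b := by omega
        subst this
        exact Or.inr (Or.inl (Or.inl ⟨rfl, rfl⟩))

theorem route_down {a b : ℕ} (hab : a ≤ b) :
    Route (Set.Icc a b) ((b - a) • {1}) b a (Set.Ico a b) :=
  (route_up hab).reverse

/-! ### Inserting new vertices above an initial segment -/

/-- A route through the vertices below `n`. -/
abbrev PathOn (n : ℕ) (M : Multiset ℕ) (s e : ℕ) (E : Set ℕ) : Prop := Route (Set.Iio n) M s e E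

theorem PathOn.reverse {n : ℕ} {M : Multiset ℕ} {s e : ℕ} {E : Set ℕ}
    (h : PathOn n M s e E) : PathOn n M e s E := Route.reverse h

theorem PathOn.cast {n n' : ℕ} {M M' : Multiset ℕ} {s s' e e' : ℕ} {E E' : Set ℕ}
    (h : PathOn n M s e E) (hn : n' = n) (hM : M' = M) (hs : s' = s) (he : e' = e)
    (hE : ∀ p ∈ E', p ∈ E) : PathOn n' M' s' e' E' :=
  h.congr (fun v => by rw [hn]) hM hs he hE

theorem PathOn.startInsert {n : ℕ} {M : Multiset ℕ} {s e : ℕ} {E : Set ℕ}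
    (h : PathOn n M s e E) {z : ℕ} (hz : s + z = n) :
    PathOn (n + 1) (M + {z}) n e E := by
  refine ((route_singleton n).append h ?_).congr ?_ ?_ rfl rfl ?_
  · simp
  · intro v; simp only [Set.mem_Iio, Set.mem_union, Set.mem_singleton_iff]; omega
  · rw [zero_add]; congr 2; unfold gap; omega
  · simp

/-- Append the vertex `n`, and then `n + 1`, at the end. -/
theorem PathOn.endInsertUp {n : ℕ} {M : Multiset ℕ} {s e : ℕ} {E : Set ℕ}
    (h : PathOn n M s e E) {z : ℕ} (hz : e + z = n) :
    PathOn (n + 2) (M + {z} + {1}) s (n + 1) (E ∪ {n}) := by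
  refine (h.append (route_up (Nat.le_succ n)) ?_).congr ?_ ?_ rfl rfl ?_
  · intro v; simp only [Set.mem_Iio, Set.mem_Icc]; omega
  · intro v; simp only [Set.mem_Iio, Set.mem_union, Set.mem_Icc]; omega
  · have : gap e n = z := by unfold gap; omega
    simp [this, add_right_comm]
  · intro p; simp only [Set.mem_union, Set.mem_singleton_iff, Set.mem_Ico]
    rintro (h | h)
    · exact Or.inl h
    · right; omega

/-- Append the vertex `n + 1`, and then `n`, at the end. -/
theorem PathOn.endInsertDown {n : ℕ} {M : Multiset ℕ} {s e : ℕ} {E : Set ℕ}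
    (h : PathOn n M s e E) {z : ℕ} (hz : e + z = n + 1) :
    PathOn (n + 2) (M + {z} + {1}) s n (E ∪ {n}) := by
  refine (h.append (route_down (Nat.le_succ n)) ?_).congr ?_ ?_ rfl rfl ?_
  · intro v; simp only [Set.mem_Iio, Set.mem_Icc]; omega
  · intro v; simp only [Set.mem_Iio, Set.mem_union, Set.mem_Icc]; omega
  · have : gap e n.succ = z := by unfold gap; omega
    simp [this, add_right_comm]
  · intro p; simp only [Set.mem_union, Set.mem_singleton_iff, Set.mem_Ico]
    rintro (h | h)
    · exact Or.inl h
    · right; omega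

/-- Replace the step between `p` and `p + 1` by a detour through the new vertices `n`, `n + 1`. -/
theorem PathOn.pairInsert {n : ℕ} {M : Multiset ℕ} {s e : ℕ} {E : Set ℕ}
    (h : PathOn n M s e E) {p z : ℕ} (hp : p ∈ E) (hz : p + z = n) :
    PathOn (n + 2) (M + 2 • {z}) s e ({q | q ∈ E ∧ q ≠ p} ∪ {n}) := by
  obtain ⟨l, h1, h2, h3, h4, h5, h6⟩ := h
  -- The path may traverse the step upwards or downwards; in both cases `a, b` becomes `a, c, d, b`
  -- with `c` above `a` and `d` above `b`.
  have key : ∀ a b c d : ℕ, ∀ u v : List ℕ, (a = p ∧ b = p + 1 ∧ c = n ∧ d = n + 1 ∨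
      a = p + 1 ∧ b = p ∧ c = n + 1 ∧ d = n) → l = u ++ a :: b :: v →
      PathOn (n + 2) (M + 2 • {z}) s e ({q | q ∈ E ∧ q ≠ p} ∪ {n}) := by
    intro a b c d u v habcd hl
    subst hl
    have hab : gap a b = 1 := by unfold gap; omega
    have hac : gap a c = z := by unfold gap; omega
    have hcd : gap c d = 1 := by unfold gap; omega
    have hdb : gap d b = z := by unfold gap; omega
    have hperm : (u ++ a :: c :: d :: b :: v).Perm (c :: d :: (u ++ a :: b :: v)) := by
      have e1 : u ++ a :: c :: d :: b :: v = (u ++ [a]) ++ ([c, d] ++ b :: v) := by simp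
      have e2 : c :: d :: (u ++ a :: b :: v) = [c, d] ++ ((u ++ [a]) ++ b :: v) := by simp
      rw [e1, e2, ← List.append_assoc, ← List.append_assoc]
      exact List.Perm.append_right _ List.perm_append_comm
    refine ⟨u ++ a :: c :: d :: b :: v, ?_, ?_, ?_, ?_, ?_, ?_⟩
    · rw [hperm.nodup_iff]
      have hc : c ∉ u ++ a :: b :: v := by rw [h2]; simp only [Set.mem_Iio]; omega
      have hd : d ∉ u ++ a :: b :: v := by rw [h2]; simp only [Set.mem_Iio]; omega
      rw [List.nodup_cons, List.nodup_cons, List.mem_cons]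
      refine ⟨?_, hd, h1⟩
      rintro (h | h)
      · omega
      · exact hc h
    · intro w
      rw [hperm.mem_iff, List.mem_cons, List.mem_cons, h2]
      simp only [Set.mem_Iio]; omega
    · rw [← h3, gaps_append, gaps_append u a (b :: v)]
      simp only [gaps, hab, hac, hcd, hdb, ← Multiset.singleton_add]
      abel
    · cases u with
      | nil => simpa using h4
      | cons x u => simpa using h4
    · have e1 : u ++ a :: c :: d :: b :: v = (u ++ [a, c, d]) ++ b :: v := by simp
      have e2 : u ++ a :: b :: v = (u ++ [a]) ++ b :: v := by simp
      rw [e2, List.getLast?_append] at h5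
      rw [e1, List.getLast?_append]
      have : ∃ x, (b :: v).getLast? = some x := ⟨_, List.getLast?_eq_getLast_of_ne_nil (by simp)⟩
      obtain ⟨x, hx⟩ := this
      rw [hx] at h5 ⊢
      simpa using h5
    · rintro q (⟨hq, hqp⟩ | hq)
      · have := h6 q hq
        rw [linked_append] at this ⊢
        simp only [Linked] at this ⊢
        rcases this with h | h | h
        · exact Or.inl h
        · omega
        · exact Or.inr (Or.inr (Or.inr (Or.inr h)))
      · rw [linked_append]
        simp only [Set.mem_singleton_iff] at hq
        right; right
        left
        omega
  obtain ⟨u, v, hl | hl⟩ := (h6 p hp).exists_append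
  · exact key p (p + 1) n (n + 1) u v (Or.inl ⟨rfl, rfl, rfl, rfl⟩) hl
  · exact key (p + 1) p (n + 1) n u v (Or.inr ⟨rfl, rfl, rfl, rfl⟩) hl

/-- Insert pairs of vertices at distance `z` above the `k` pairs starting at `m`. -/
theorem PathOn.pairRow {n : ℕ} {M : Multiset ℕ} {s e : ℕ} {E : Set ℕ}
    (h : PathOn n M s e E) {m z : ℕ} (hn : m + z = n) (k : ℕ) (hz : 2 * k ≤ z)
    (hE : ∀ i < k, m + 2 * i ∈ E) :
    PathOn (n + 2 * k) (M + (2 * k) • {z}) s e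
      ({p | p ∈ E ∧ m + 2 * k ≤ p} ∪ {p | ∃ i < k, p = n + 2 * i}) := by
  induction k with
  | zero => exact h.congr (by simp) (by simp) rfl rfl (by simp +contextual)
  | succ k ih =>
    have ih := ih (by omega) fun i hi => hE i (by omega)
    have hmem : m + 2 * k ∈ ({p | p ∈ E ∧ m + 2 * k ≤ p} ∪ {p | ∃ i < k, p = n + 2 * i} : Set ℕ) :=
      Or.inl ⟨hE k (by omega), le_rfl⟩
    refine (ih.pairInsert hmem (z := z) (by omega)).congr ?_ ?_ rfl rfl ?_
    · intro v; simp only [Set.mem_Iio]; omega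
    · module
    · rintro p (⟨hp, hp'⟩ | ⟨i, hi, rfl⟩)
      · exact Or.inl ⟨Or.inl ⟨hp, by omega⟩, by omega⟩
      -- The new links start at `m + z`, and the bound on `z` keeps them clear of the link `m + 2 *
      -- k` now consumed.
      · rcases Nat.lt_or_ge i k with h | h
        · exact Or.inl ⟨Or.inr ⟨i, h, rfl⟩, by omega⟩
        · right
          simp only [Set.mem_singleton_iff]
          omega

/-- Reflection of the vertex set. -/
theorem PathOn.flip {n : ℕ} {M : Multiset ℕ} {s e : ℕ} {E : Set ℕ}
    (h : PathOn n M s e E) : PathOn n M (n - 1 - s) (n - 1 - e) ∅ := by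
  obtain ⟨l, h1, h2, h3, h4, h5, h6⟩ := h
  refine ⟨l.map fun v => n - 1 - v, ?_, ?_, ?_, ?_, ?_, by simp⟩
  · refine (List.nodup_map_iff_inj_on h1).2 fun a ha b hb hab => ?_
    rw [h2] at ha hb
    simp only [Set.mem_Iio] at ha hb hab
    omega
  · intro v
    simp only [List.mem_map, h2, Set.mem_Iio]
    constructor
    · rintro ⟨a, ha, rfl⟩; omega
    · intro hv; exact ⟨n - 1 - v, by omega, by omega⟩
  · rw [gaps_map, h3]
    intro a ha b hb
    rw [h2] at ha hb
    simp only [Set.mem_Iio] at ha hb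
    unfold gap; omega
  · simp [h4]
  · simp [h5]

theorem Route.shift {V : Set ℕ} {M : Multiset ℕ} {s e : ℕ} {E : Set ℕ}
    (h : Route V M s e E) (d : ℕ) : Route {v | d ≤ v ∧ v - d ∈ V} M (s + d) (e + d) ∅ := by
  obtain ⟨l, h1, h2, h3, h4, h5, h6⟩ := h
  refine ⟨l.map fun v => v + d, ?_, ?_, ?_, ?_, ?_, by simp⟩
  · exact h1.map fun a b hab => by simpa using hab
  · intro v
    simp only [List.mem_map, h2, Set.mem_ofPred_eq]
    constructor
    · rintro ⟨a, ha, rfl⟩; simpa using ha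
    · intro hv; exact ⟨v - d, hv.2, by omega⟩
  · rw [gaps_map, h3]
    intro a _ b _
    unfold gap; omega
  · simp [h4]
  · simp [h5]

/-- Concatenation of two routes sharing the end of the first and the start of the second. -/
theorem Route.glue {V V' : Set ℕ} {M M' : Multiset ℕ} {s e e' : ℕ} {E E' : Set ℕ}
    (h : Route V M s e E) (h' : Route V' M' e e' E')
    (hd : ∀ v, v ∈ V → v ∈ V' → v = e) : Route (V ∪ V') (M + M') s e' ∅ := by
  obtain ⟨l, h1, h2, h3, h4, h5, h6⟩ := h
  obtain ⟨l', h1', h2', h3', h4', h5', h6'⟩ := h'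
  obtain ⟨u, rfl⟩ : ∃ u, l = u ++ [e] := List.getLast?_eq_some_iff.1 h5
  obtain ⟨w, rfl⟩ : ∃ w, l' = e :: w := List.head?_eq_some_iff.1 h4'
  refine ⟨u ++ e :: w, ?_, ?_, ?_, ?_, ?_, by simp⟩
  · rw [List.nodup_append] at h1 ⊢
    refine ⟨h1.1, h1', fun a ha b hb hab => ?_⟩
    subst hab
    have : a = e := hd a ((h2 a).1 (by simp [ha])) ((h2' a).1 hb)
    exact h1.2.2 a ha e (by simp) this
  · intro v
    rw [Set.mem_union, ← h2, ← h2']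
    simp only [List.mem_append, List.mem_cons, List.not_mem_nil, or_false]
    tauto
  · rw [gaps_append, h3, h3']
  · cases u with
    | nil => simpa using h4
    | cons x u => simpa using h4
  · rw [List.getLast?_append, h5']; rfl

/-! ### Standard paths and gluing -/

/-- `Standard M`: there is a route through an initial segment of `ℕ` that starts at `0` and has
multiset of distances `M`. -/
def Standard (M : Multiset ℕ) : Prop := ∃ n e, PathOn n M 0 e ∅

theorem PathOn.standard {n : ℕ} {M : Multiset ℕ} {e : ℕ} {E : Set ℕ}
    (h : PathOn n M 0 e E) : Standard M :=
  ⟨n, e, h.cast rfl rfl rfl rfl (by simp)⟩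

theorem PathOn.standard_of_top {n : ℕ} {M : Multiset ℕ} {s e : ℕ} {E : Set ℕ}
    (h : PathOn n M s e E) (hs : s = n - 1) : Standard M :=
  ⟨n, n - 1 - e, h.flip.cast rfl rfl (by omega) rfl (by simp)⟩

theorem PathOn.pos {n : ℕ} {M : Multiset ℕ} {s e : ℕ} {E : Set ℕ} (h : PathOn n M s e E) :
    s < n := by
  obtain ⟨l, h1, h2, h3, h4, h5, h6⟩ := h
  exact (h2 s).1 (List.mem_of_mem_head? h4)

/-- After reflection the path starts at its top vertex, and the next integer can be put in front of
it. -/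
theorem Standard.add_ones {M : Multiset ℕ} (h : Standard M) (j : ℕ) : Standard (M + j • {1}) := by
  induction j with
  | zero => simpa using h
  | succ j ih =>
    obtain ⟨n, e, h⟩ := ih
    have hn := h.pos
    have := PathOn.startInsert (z := 1) h.flip (by omega)
    have := this.standard_of_top rfl
    rwa [add_smul, one_smul, ← add_assoc]

/-- The multiset `M` is the multiset of distances of a route through an initial segment. -/
def LinearPath (M : Multiset ℕ) : Prop := ∃ n s e, PathOn n M s e ∅

theorem Standard.linearPath {M : Multiset ℕ} (h : Standard M) : LinearPath M := by
  obtain ⟨n, e, h⟩ := h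
  exact ⟨n, 0, e, h⟩

theorem Standard.add {M M' : Multiset ℕ} (h : Standard M) (h' : Standard M') :
    LinearPath (M + M') := by
  obtain ⟨n, e, h⟩ := h
  obtain ⟨n', e', h'⟩ := h'
  have hn := h.pos
  have hn' := h'.pos
  refine ⟨n + n' - 1, n - 1 - e, e' + (n - 1), ?_⟩
  have h1 : PathOn n M (n - 1 - e) (0 + (n - 1)) ∅ := h.flip.reverse.cast rfl rfl rfl (by omega) (by simp)
  refine (Route.glue h1 (Route.shift h' (n - 1)) ?_).congr ?_ rfl rfl rfl (by simp)
  · intro v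
    simp only [Set.mem_Iio, Set.mem_ofPred_eq]; omega
  · intro v
    simp only [Set.mem_Iio, Set.mem_ofPred_eq, Set.mem_union]; omega

/-! ### Growing by whole rows -/

/-- For odd `y = 2 * h + 1`, a path that starts at the top vertex and links the `h` pairs just below
it can be extended by `y` vertices using `y` edges of length `y`. -/
theorem PathOn.oddRows {n : ℕ} {M : Multiset ℕ} {e : ℕ} {E : Set ℕ} {m h : ℕ}
    (hp : PathOn n M (n - 1) e E) (hn : m + (2 * h + 1) = n) (hE : ∀ i < h, m + 2 * i ∈ E) (q : ℕ) :
    PathOn (n + q * (2 * h + 1)) (M + (q * (2 * h + 1)) • {2 * h + 1})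
      (n + q * (2 * h + 1) - 1) e {p | ∃ i < h, p = m + q * (2 * h + 1) + 2 * i} := by
  induction q with
  | zero =>
    refine hp.cast (by simp) (by simp) (by simp) rfl ?_
    rintro p ⟨i, hi, rfl⟩
    simpa using hE i hi
  | succ q ih =>
    have h1 := ih.pairRow (m := m + q * (2 * h + 1)) (z := 2 * h + 1) (by omega) h (by omega)
      fun i hi => ⟨i, hi, rfl⟩
    -- The pairs fill the new row except for its last vertex, which lies at distance `2 * h + 1`
    -- from the start, the old top vertex.
    have h2 := h1.startInsert (z := 2 * h + 1) (by omega)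
    refine h2.cast (by ring) (by module) ?_ rfl ?_
    · have : (q + 1) * (2 * h + 1) = q * (2 * h + 1) + (2 * h + 1) := by ring
      omega
    · rintro p ⟨i, hi, rfl⟩
      refine Or.inr ⟨i, hi, ?_⟩
      rw [← hn]; ring

/-- For even `y = 2 * h`, a path that links the top `h` pairs can be extended two by two. -/
theorem PathOn.evenRows {n : ℕ} {M : Multiset ℕ} {s e : ℕ} {E : Set ℕ} {m h : ℕ}
    (hp : PathOn n M s e E) (hn : m + 2 * h = n) (hh : 1 ≤ h) (hE : ∀ i < h, m + 2 * i ∈ E) (q : ℕ) :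
    PathOn (n + 2 * q) (M + (2 * q) • {2 * h}) s e {p | ∃ i < h, p = m + 2 * q + 2 * i} := by
  induction q with
  | zero =>
    refine hp.cast (by simp) (by simp) rfl rfl ?_
    rintro p ⟨i, hi, rfl⟩
    simpa using hE i hi
  | succ q ih =>
    -- The lowest pair of the window is consumed and the new pair closes the window shifted by two.
    have h1 := ih.pairInsert (p := m + 2 * q) (z := 2 * h) ⟨0, hh, rfl⟩ (by omega)
    refine h1.cast (by ring) (by module) rfl rfl ?_
    rintro p ⟨i, hi, rfl⟩
    by_cases hi' : i + 1 = h
    · right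
      simp only [Set.mem_singleton_iff]; omega
    · exact Or.inl ⟨⟨i + 1, by omega, by ring⟩, by omega⟩

/-! ### Seeds -/

/-- The path `p, …, y, 0, …, p - 1`. -/
theorem pathOn_rotate {p y : ℕ} (hp : 1 ≤ p) (hpy : p ≤ y) :
    PathOn (y + 1) ((y - 1) • {1} + {y}) p (p - 1) {q | q < y ∧ q ≠ p - 1} := by
  refine ((route_up hpy).append (route_up (Nat.zero_le (p - 1))) ?_).congr ?_ ?_ rfl rfl ?_
  · intro v; simp only [Set.mem_Icc]; omega
  · intro v; simp only [Set.mem_Icc, Set.mem_union, Set.mem_Iio]; omega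
  · have h1 : y - 1 = (y - p) + (p - 1 - 0) := by omega
    have h2 : gap y 0 = y := by unfold gap; omega
    rw [h1, h2]; module
  · rintro q ⟨h1, h2⟩
    simp only [Set.mem_Ico, Set.mem_union]; omega

/-- The path `p, …, 0, y, …, p + 1`. -/
theorem pathOn_rotate_down {p y : ℕ} (hpy : p < y) :
    PathOn (y + 1) ((y - 1) • {1} + {y}) p (p + 1) {q | q < y ∧ q ≠ p} := by
  refine ((route_down (Nat.zero_le p)).append (route_down (Nat.succ_le_of_lt hpy)) ?_).congr ?_ ?_
    rfl rfl ?_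
  · intro v; simp only [Set.mem_Icc]; omega
  · intro v; simp only [Set.mem_Icc, Set.mem_union, Set.mem_Iio]; omega
  · have h1 : y - 1 = (p - 0) + (y - p.succ) := by omega
    have h2 : gap 0 y = y := by unfold gap; omega
    rw [h1, h2]; module
  · rintro q ⟨h1, h2⟩
    simp only [Set.mem_Ico, Set.mem_union]; omega

/-- The path `r - 1, …, 0, r, …, y - 1`. -/
theorem pathOn_down_up {r y : ℕ} (hr : 1 ≤ r) (hry : r < y) :
    PathOn y ((y - 2) • {1} + {r}) (r - 1) (y - 1) {q | q + 1 < y ∧ q ≠ r - 1} := by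
  refine ((route_down (Nat.zero_le (r - 1))).append
    (route_up (show r ≤ y - 1 by omega)) ?_).congr ?_ ?_ rfl rfl ?_
  · intro v; simp only [Set.mem_Icc]; omega
  · intro v; simp only [Set.mem_Icc, Set.mem_union, Set.mem_Iio]; omega
  · have h1 : y - 2 = (r - 1 - 0) + (y - 1 - r) := by omega
    have h2 : gap 0 r = r := by unfold gap; omega
    rw [h1, h2]; module
  · rintro q ⟨h1, h2⟩
    simp only [Set.mem_Ico, Set.mem_union]; omega

/-- The path `r, …, k, r + 1, …, y, 0, …, k - 1`. -/
theorem pathOn_three_runs {k r y : ℕ} (hk : 1 ≤ k) (hkr : k ≤ r) (hry : r < y) :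
    PathOn (y + 1) ((y - 2) • {1} + {r + 1 - k} + {y}) r (k - 1)
      {q | q < y ∧ q ≠ r ∧ q ≠ k - 1} := by
  have h1 := (route_down hkr).append (route_up (Nat.succ_le_of_lt hry)) (by
    intro v; simp only [Set.mem_Icc]; omega)
  refine (h1.append (route_up (Nat.zero_le (k - 1))) ?_).congr ?_ ?_ rfl rfl ?_
  · intro v; simp only [Set.mem_Icc, Set.mem_union]; omega
  · intro v; simp only [Set.mem_Icc, Set.mem_union, Set.mem_Iio]; omega
  · have h1 : y - 2 = (r - k) + (y - r.succ) + (k - 1 - 0) := by omega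
    have h2 : gap y 0 = y := by unfold gap; omega
    have h3 : gap k r.succ = r + 1 - k := by unfold gap; omega
    rw [h1, h2, h3]; module
  · rintro q ⟨h1, h2, h3⟩
    simp only [Set.mem_Ico, Set.mem_union]; omega

/-! ### Standard realizations with lengths 1 and y -/

/-- Insertions use the long edges two at a time, so the parity of `b` is settled by the seed: a
plain run, or `0, y, y - 1, …, 1` with `y = 2 * h`. -/
theorem standard_even {h : ℕ} (hh : 1 ≤ h) (b : ℕ) :
    Standard ((2 * h - 1) • {1} + b • {2 * h}) := by
  obtain ⟨q, rfl | rfl⟩ : ∃ q, b = 2 * q ∨ b = 2 * q + 1 := ⟨b / 2, by omega⟩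
  · have h0 : PathOn (2 * h) ((2 * h - 1) • {1}) 0 (2 * h - 1) (Set.Ico 0 (2 * h - 1)) :=
      (route_up (Nat.zero_le _)).congr (fun v => by simp only [Set.mem_Icc, Set.mem_Iio]; omega)
        (by simp) rfl rfl (fun _ h => h)
    exact (h0.evenRows (m := 0) (by omega) hh
      (fun i hi => by simp only [Set.mem_Ico]; omega) q).standard
  · have h0 := pathOn_rotate_down (p := 0) (y := 2 * h) (by omega)
    have h1 := h0.evenRows (m := 1) (by omega) hh
      (fun i hi => by simp only [Set.mem_ofPred_eq]; omega) q
    have : (2 * h - 1) • {1} + (2 * q + 1) • {2 * h}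
        = (2 * h - 1) • ({1} : Multiset ℕ) + {2 * h} + (2 * q) • {2 * h} := by module
    rw [this]
    exact h1.standard

/-- A decreasing run ends at 0 and starts at its top, so `q` full rows fit, followed by `k` pairs of
a last partial row. -/
theorem standard_odd_even {h k : ℕ} (hk : k ≤ h) (q : ℕ) :
    Standard ((2 * h) • {1} + (q * (2 * h + 1) + 2 * k) • {2 * h + 1}) := by
  have h0 : PathOn (2 * h + 1) ((2 * h) • {1}) (2 * h + 1 - 1) 0 (Set.Ico 0 (2 * h)) :=
    (route_down (Nat.zero_le (2 * h))).congr
      (fun v => by simp only [Set.mem_Icc, Set.mem_Iio]; omega) (by simp) rfl rfl (fun _ h => h)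
  have h1 := PathOn.oddRows (m := 0) (h := h) h0 (by omega) (fun i hi => by simp only [Set.mem_Ico]; omega) q
  have h2 := h1.pairRow (m := q * (2 * h + 1)) (z := 2 * h + 1) (by omega) k (by omega)
    (fun i hi => by simp only [Set.mem_ofPred_eq]; exact ⟨i, by omega, by omega⟩)
  have := h2.reverse.standard
  rwa [add_assoc, ← add_smul] at this

theorem standard_odd_one {h : ℕ} (hh : 1 ≤ h) (q : ℕ) :
    Standard ((2 * h) • {1} + (q * (2 * h + 1) + 1) • {2 * h + 1}) := by
  have h0 := pathOn_rotate (p := 2 * h + 1) (y := 2 * h + 1) (by omega) le_rfl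
  have h1 := PathOn.oddRows (m := 1) (h := h) h0 (by omega)
    (fun i hi => by simp only [Set.mem_ofPred_eq]; omega) q
  have : (2 * h) • {1} + (q * (2 * h + 1) + 1) • {2 * h + 1}
        = (2 * h + 1 - 1) • ({1} : Multiset ℕ) + {2 * h + 1}
          + (q * (2 * h + 1)) • {2 * h + 1} := by
    rw [Nat.add_sub_cancel]; module
  rw [this]
  exact h1.standard_of_top rfl

/-- Adding a pair of vertices at the end of the path costs one long edge and the extra 1, instead of
two long edges; this corrects the parity. -/
theorem standard_odd_extra {h g : ℕ} (hg : 1 ≤ g) (hgh : g < h) (q : ℕ) :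
    Standard ((2 * h + 1) • {1} + (q * (2 * h + 1) + (2 * g + 1)) • {2 * h + 1}) := by
  have h0 := pathOn_rotate (p := 2 * g + 1) (y := 2 * h + 1) (by omega) (by omega)
  have h1 := h0.pairRow (m := 1) (z := 2 * h + 1) (by omega) (g - 1) (by omega)
    (fun i hi => by simp only [Set.mem_ofPred_eq]; omega)
  have h2 := h1.endInsertDown (z := 2 * h + 1) (by omega)
  have h3 := h2.startInsert (z := 2 * h + 1) (by omega)
  have h4 := PathOn.oddRows (m := 2 * g + 2) (h := h)
    (h3.cast rfl rfl (s' := _ - 1) (by omega) rfl fun _ h => h) (by omega) (fun i hi => by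
      simp only [Set.mem_ofPred_eq, Set.mem_union, Set.mem_singleton_iff]
      -- The window of pairs straddles the seed and the partial row. The row sits at odd distance
      -- over odd links, so its links are even, like those still needed in the seed.
      rcases Nat.lt_or_ge (2 * g + 2 + 2 * i) (2 * h + 1) with hlt | hge
      · left; left; omega
      · rcases Nat.lt_or_ge (i + 1) h with h' | h'
        · left; right; exact ⟨i + g - h, by omega, by omega⟩
        · right; omega) q
  have := h4.standard_of_top rfl
  refine (congrArg Standard ?_).mp this
  obtain ⟨g, rfl⟩ : ∃ k, g = k + 1 := ⟨g - 1, by omega⟩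
  simp only [Nat.add_sub_cancel]
  module

/-! ### Repairing the parity with one edge x -/

section
variable {h g : ℕ}

/-- The edge `x` joins the start of the seed to the new top vertex, in place of an edge `2 * h + 1`.
-/
theorem standard_mixed_large {x : ℕ} (hg : 1 ≤ g) (hgh : g < h) (hx : 2 * g + 1 < x)
    (hxh : x < 2 * h + 1) (q : ℕ) :
    Standard ((2 * h) • {1} + {x} + (q * (2 * h + 1) + (2 * g + 1)) • {2 * h + 1}) := by
  -- The seed has `2 * h + 2` vertices and `g` pairs are added, so the next vertex is `2 * h + 2 * g
  -- + 2`; hence the starting point `p`.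
  obtain ⟨p, hp⟩ : ∃ p, p + x = 2 * h + 2 * g + 2 := ⟨2 * h + 2 * g + 2 - x, by omega⟩
  have key : ∀ e E, PathOn (2 * h + 1 + 1) ((2 * h + 1 - 1) • {1} + {2 * h + 1}) p e E →
      (∀ i, 1 + 2 * i ∈ E ∨ 2 * g + 1 ≤ 1 + 2 * i) →
      (∀ i, 2 * g + 2 + 2 * i < 2 * h + 1 → 2 * g + 2 + 2 * i ∈ E) →
      Standard ((2 * h) • {1} + {x} + (q * (2 * h + 1) + (2 * g + 1)) • {2 * h + 1}) := by
    intro e E h0 hE1 hE2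
    have h1 := h0.pairRow (m := 1) (z := 2 * h + 1) (by omega) g (by omega)
      (fun i hi => (hE1 i).resolve_right (by omega))
    have h2 := h1.startInsert (z := x) (by omega)
    have h3 := PathOn.oddRows (m := 2 * g + 2) (h := h)
      (h2.cast rfl rfl (s' := _ - 1) (by omega) rfl fun _ h => h) (by omega) (fun i hi => by
        rcases Nat.lt_or_ge (2 * g + 2 + 2 * i) (2 * h + 1) with hlt | hge
        · exact Or.inl ⟨hE2 i hlt, by omega⟩
        · exact Or.inr ⟨i + g - h, by omega, by omega⟩) q
    have := h3.standard_of_top rfl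
    refine (congrArg Standard ?_).mp this
    simp only [Nat.add_sub_cancel]
    module
  -- The seed lacks the link `p - 1` or `p`. The choice makes it odd, which is harmless since only
  -- even links are needed beyond `2 * g + 1`.
  rcases Nat.even_or_odd' p with ⟨c, hc | hc⟩
  · refine key _ _ (pathOn_rotate (p := p) (y := 2 * h + 1) (by omega) (by omega)) ?_ ?_
    · intro i; simp only [Set.mem_ofPred_eq]; omega
    · intro i; simp only [Set.mem_ofPred_eq]; omega
  · refine key _ _ (pathOn_rotate_down (p := p) (y := 2 * h + 1) (by omega)) ?_ ?_
    · intro i; simp only [Set.mem_ofPred_eq]; omega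
    · intro i; simp only [Set.mem_ofPred_eq]; omega

/-- Here the edge `x` lies in the seed, jumping from 0 to `2 * g + 1`; one 1 is saved and appended
at the end. -/
theorem standard_mixed_equal (hg : 1 ≤ g) (hgh : g < h) (q : ℕ) :
    Standard ((2 * h) • {1} + {2 * g + 1} + (q * (2 * h + 1) + (2 * g + 1)) • {2 * h + 1}) := by
  have h0 := pathOn_down_up (r := 2 * g + 1) (y := 2 * h + 1) (by omega) (by omega)
  have h1 := h0.pairRow (m := 0) (z := 2 * h + 1) (by omega) g (by omega)
    (fun i hi => by simp only [Set.mem_ofPred_eq]; omega)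
  have h2 := h1.startInsert (z := 2 * h + 1) (by omega)
  have h3 := PathOn.oddRows (m := 2 * g + 1) (h := h)
    (h2.cast rfl rfl (s' := _ - 1) (by omega) rfl fun _ h => h) (by omega) (fun i hi => by
      simp only [Set.mem_ofPred_eq, Set.mem_union]
      rcases Nat.lt_or_ge (2 * g + 1 + 2 * i) (2 * h + 1) with hlt | hge
      · left; omega
      · right; exact ⟨i + g - h, by omega, by omega⟩) q
  have := (h3.standard_of_top rfl).add_ones 1
  refine (congrArg Standard ?_).mp this
  obtain ⟨h, rfl⟩ : ∃ k, h = k + 1 := ⟨h - 1, by omega⟩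
  have : 2 * (h + 1) + 1 - 2 = 2 * h + 1 := by omega
  rw [this]
  module

/-- The edge `x` joins the first two runs of the seed and saves a 1, which pays for the pair added
at the end of the path. That pair takes its place inside the partial row, between two blocks of
inserted pairs. -/
theorem standard_mixed_even {k : ℕ} (hk : 1 ≤ k) (hkg : k ≤ g) (hgh : g < h) (q : ℕ) :
    Standard ((2 * h) • {1} + {2 * g + 2 - 2 * k}
      + (q * (2 * h + 1) + (2 * g + 1)) • {2 * h + 1}) := by
  have h0 := pathOn_three_runs (k := 2 * k) (r := 2 * g + 1) (y := 2 * h + 1)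
    (by omega) (by omega) (by omega)
  have h1 := h0.pairRow (m := 1) (z := 2 * h + 1) (by omega) (k - 1) (by omega)
    (fun i hi => by simp only [Set.mem_ofPred_eq]; omega)
  have h2 := h1.endInsertUp (z := 2 * h + 1) (by omega)
  have h3 := h2.pairRow (m := 2 * k + 1) (z := 2 * h + 1) (by omega) (g - k) (by omega)
    (fun i hi => by left; left; simp only [Set.mem_ofPred_eq]; omega)
  have h4 := h3.startInsert (z := 2 * h + 1) (by omega)
  have h5 := PathOn.oddRows (m := 2 * g + 2) (h := h)
    (h4.cast rfl rfl (s' := _ - 1) (by omega) rfl fun _ h => h) (by omega) (fun i hi => by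
      simp only [Set.mem_ofPred_eq, Set.mem_union, Set.mem_singleton_iff]
      rcases Nat.lt_or_ge (2 * g + 2 + 2 * i) (2 * h + 1) with hlt | hge
      · left; refine ⟨?_, by omega⟩; left; left; omega
      · rcases lt_trichotomy (g + 1 + i) (h + k) with h' | h' | h'
        · left; refine ⟨?_, by omega⟩; left; right; exact ⟨g + i - h, by omega, by omega⟩
        · left; refine ⟨?_, by omega⟩; right; omega
        · right; exact ⟨g + i - h - k, by omega, by omega⟩) q
  have := h5.standard_of_top rfl
  refine (congrArg Standard ?_).mp this
  obtain ⟨k, rfl⟩ : ∃ c, k = c + 1 := ⟨k - 1, by omega⟩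
  obtain ⟨g, rfl⟩ : ∃ c, g = c + (k + 1) := ⟨g - (k + 1), by omega⟩
  obtain ⟨h, rfl⟩ : ∃ c, h = c + 1 := ⟨h - 1, by omega⟩
  have e1 : 2 * (h + 1) + 1 - 2 = 2 * h + 1 := by omega
  have e2 : 2 * (g + (k + 1)) + 1 + 1 - 2 * (k + 1) = 2 * (g + (k + 1)) + 2 - 2 * (k + 1) := by
    omega
  simp only [e1, e2, Nat.add_sub_cancel]
  module

/-- Same scheme as `standard_mixed_even`; the path now ends at an even vertex, so the pair at the
end is traversed downwards. -/
theorem standard_mixed_odd {k : ℕ} (hk : 1 ≤ k) (hkg : k < g) (hgh : g < h) (q : ℕ) :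
    Standard ((2 * h) • {1} + {2 * g + 1 - 2 * k}
      + (q * (2 * h + 1) + (2 * g + 1)) • {2 * h + 1}) := by
  have h0 := pathOn_three_runs (k := 2 * k + 1) (r := 2 * g + 1) (y := 2 * h + 1)
    (by omega) (by omega) (by omega)
  have h1 := h0.pairRow (m := 1) (z := 2 * h + 1) (by omega) (k - 1) (by omega)
    (fun i hi => by simp only [Set.mem_ofPred_eq]; omega)
  have h2 := h1.endInsertDown (z := 2 * h + 1) (by omega)
  have h3 := h2.pairRow (m := 2 * k + 1) (z := 2 * h + 1) (by omega) (g - k) (by omega)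
    (fun i hi => by left; left; simp only [Set.mem_ofPred_eq]; omega)
  have h4 := h3.startInsert (z := 2 * h + 1) (by omega)
  have h5 := PathOn.oddRows (m := 2 * g + 2) (h := h)
    (h4.cast rfl rfl (s' := _ - 1) (by omega) rfl fun _ h => h) (by omega) (fun i hi => by
      simp only [Set.mem_ofPred_eq, Set.mem_union, Set.mem_singleton_iff]
      rcases Nat.lt_or_ge (2 * g + 2 + 2 * i) (2 * h + 1) with hlt | hge
      · left; refine ⟨?_, by omega⟩; left; left; omega
      · rcases lt_trichotomy (g + 1 + i) (h + k) with h' | h' | h'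
        · left; refine ⟨?_, by omega⟩; left; right; exact ⟨g + i - h, by omega, by omega⟩
        · left; refine ⟨?_, by omega⟩; right; omega
        · right; exact ⟨g + i - h - k, by omega, by omega⟩) q
  have := h5.standard_of_top rfl
  refine (congrArg Standard ?_).mp this
  obtain ⟨k, rfl⟩ : ∃ c, k = c + 1 := ⟨k - 1, by omega⟩
  obtain ⟨g, rfl⟩ : ∃ c, g = c + (k + 1) := ⟨g - (k + 1), by omega⟩
  obtain ⟨h, rfl⟩ : ∃ c, h = c + 1 := ⟨h - 1, by omega⟩
  have e1 : 2 * (h + 1) + 1 - 2 = 2 * h + 1 := by omega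
  have e2 : 2 * (g + (k + 1)) + 1 + 1 - (2 * (k + 1) + 1)
      = 2 * (g + (k + 1)) + 1 - 2 * (k + 1) := by omega
  simp only [e1, e2, Nat.add_sub_cancel]
  module

end

theorem standard_mixed {h g x : ℕ} (hg : 1 ≤ g) (hgh : g < h) (hx : 1 < x) (hxh : x < 2 * h + 1)
    (q : ℕ) :
    Standard ((2 * h) • {1} + {x} + (q * (2 * h + 1) + (2 * g + 1)) • {2 * h + 1}) := by
  rcases lt_trichotomy x (2 * g + 1) with hlt | rfl | hgt
  · rcases Nat.even_or_odd' x with ⟨c, rfl | rfl⟩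
    · have := standard_mixed_even (k := g + 1 - c) (by omega) (by omega) hgh q
      rwa [show 2 * g + 2 - 2 * (g + 1 - c) = 2 * c by omega] at this
    · have := standard_mixed_odd (k := g - c) (by omega) (by omega) hgh q
      rwa [show 2 * g + 1 - 2 * (g - c) = 2 * c + 1 by omega] at this
  · exact standard_mixed_equal hg hgh q
  · exact standard_mixed_large hg hgh hgt hxh q

/-! ### Linear realizations from two halves -/

theorem standard_or_exceptional {y : ℕ} (hy : 2 ≤ y) (c : ℕ) :
    Standard ((y - 1) • {1} + c • {y}) ∨
      ∃ h g q, 1 ≤ g ∧ g < h ∧ y = 2 * h + 1 ∧ c = q * (2 * h + 1) + (2 * g + 1) := by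
  rcases Nat.even_or_odd' y with ⟨h, rfl | rfl⟩
  · exact Or.inl (standard_even (by omega) c)
  · have hc := Nat.div_add_mod' c (2 * h + 1)
    have hlt := Nat.mod_lt c (show 2 * h + 1 > 0 by omega)
    rw [Nat.add_sub_cancel]
    rcases Nat.even_or_odd' (c % (2 * h + 1)) with ⟨g, hg | hg⟩
    · left
      rw [← hc, hg]
      exact standard_odd_even (by omega) _
    · by_cases hg0 : g = 0
      · left
        rw [← hc, hg, hg0]
        exact standard_odd_one (by omega) _
      · right
        exact ⟨h, g, c / (2 * h + 1), by omega, by omega, rfl, by omega⟩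

theorem standard_ones {y : ℕ} (hy : 2 ≤ y) (c : ℕ) : Standard (y • {1} + c • {y}) := by
  rcases standard_or_exceptional hy c with h | ⟨h, g, q, hg, hgh, rfl, rfl⟩
  · have := h.add_ones 1
    obtain ⟨y, rfl⟩ : ∃ k, y = k + 1 := ⟨y - 1, by omega⟩
    refine (congrArg Standard ?_).mp this
    rw [Nat.add_sub_cancel]
    module
  · exact standard_odd_extra hg hgh q

theorem standard_of_even_or_three {x : ℕ} (hx : 2 ≤ x) (h : x = 3 ∨ Even x) (b : ℕ) :
    Standard ((x - 1) • {1} + b • {x}) := by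
  rcases standard_or_exceptional hx b with h' | ⟨k, g, q, hg, hgh, rfl, rfl⟩
  · exact h'
  · rcases h with h | ⟨c, hc⟩ <;> omega

/-- If `{1^k, x^b}` has a standard realization for every `b`, then `{1^a, x^b, y^c}` has a linear
realization for `a ≥ k + y - 1`. -/
theorem linearPath_of_standard {x y k : ℕ} (hx : 1 < x) (hxy : x < y)
    (hk : ∀ b : ℕ, Standard (k • {1} + b • {x})) (a b c : ℕ) (hk1 : 1 ≤ k) (ha : k + y - 1 ≤ a) :
    LinearPath (a • {1} + b • {x} + c • {y}) := by
  obtain ⟨d, rfl⟩ : ∃ d, a = k + y - 1 + d := ⟨a - (k + y - 1), by omega⟩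
  rcases standard_or_exceptional (show 2 ≤ y by omega) c with h | ⟨h, g, q, hg, hgh, rfl, rfl⟩
  · have := ((hk b).add_ones d).add h
    refine (congrArg LinearPath ?_).mp this
    have : k + y - 1 + d = k + (y - 1) + d := by omega
    rw [this]
    module
  -- With no `x` to borrow, the other half is not needed and its ones supply the extra 1, as `1 ≤
  -- k`; otherwise one `x` moves over.
  · rcases Nat.eq_zero_or_pos b with rfl | hb
    · have := ((standard_odd_extra hg hgh q).add_ones (k - 1 + d)).linearPath
      refine (congrArg LinearPath ?_).mp this
      have : k + (2 * h + 1) - 1 + d = 2 * h + 1 + (k - 1 + d) := by omega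
      rw [this]
      module
    · have := ((hk (b - 1)).add_ones d).add (standard_mixed hg hgh hx hxy q)
      refine (congrArg LinearPath ?_).mp this
      obtain ⟨b, rfl⟩ : ∃ e, b = e + 1 := ⟨b - 1, by omega⟩
      have : k + (2 * h + 1) - 1 + d = k + 2 * h + d := by omega
      rw [this, Nat.add_sub_cancel]
      module

/-! ### Both lengths even -/

/-- For even `2 * x ≤ 2 * y`, a path from `0` linking the top `y` pairs can be extended by any even
numbers of edges of lengths `2 * y` and `2 * x`. -/
theorem standard_of_aligned_pairs {x y : ℕ} (hx : 1 ≤ x) (hy : 1 ≤ y) {n : ℕ} {M : Multiset ℕ}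
    {e : ℕ} {E : Set ℕ} (hxy : x ≤ y) {m : ℕ} (h : PathOn n M 0 e E) (hn : m + 2 * y = n)
    (hE : ∀ i < y, m + 2 * i ∈ E) (b c : ℕ) :
    Standard (M + (2 * c) • {2 * y} + (2 * b) • {2 * x}) := by
  have h1 := h.evenRows hn hy hE c
  -- Of the `y` linked pairs at the top, the highest `x` form the window for the shorter length.
  have h2 := h1.evenRows (m := m + 2 * c + 2 * (y - x)) (h := x) (by omega) hx (fun i hi => by
    simp only [Set.mem_ofPred_eq]
    exact ⟨i + (y - x), by omega, by omega⟩) b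
  exact h2.standard

theorem linearPath_of_both_even {x y : ℕ} (hx : 1 ≤ x) (hxy : x < y) (a b c : ℕ)
    (ha : 2 * y - 1 ≤ a) : LinearPath (a • {1} + b • {2 * x} + c • {2 * y}) := by
  have hy : 1 ≤ y := by omega
  obtain ⟨d, rfl⟩ : ∃ d, a = 2 * y - 1 + d := ⟨a - (2 * y - 1), by omega⟩
  -- The seed carries the odd leftover edges, so there is one seed for each pair of parities.
  obtain ⟨b', rfl | rfl⟩ := Nat.even_or_odd' b <;> obtain ⟨c', rfl | rfl⟩ := Nat.even_or_odd' c
  · have h0 : PathOn (2 * y) ((2 * y - 1) • {1}) 0 (2 * y - 1) (Set.Ico 0 (2 * y - 1)) :=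
      (route_up (Nat.zero_le _)).congr (fun v => by simp only [Set.mem_Icc, Set.mem_Iio]; omega)
        (by simp) rfl rfl (fun _ h => h)
    have := ((standard_of_aligned_pairs hx hy hxy.le (m := 0) h0 (by omega)
      (fun i hi => by simp only [Set.mem_Ico]; omega) b' c').add_ones d).linearPath
    refine (congrArg LinearPath ?_).mp this
    module
  · have h0 := pathOn_rotate_down (p := 0) (y := 2 * y) (by omega)
    have := ((standard_of_aligned_pairs hx hy hxy.le (m := 1) h0 (by omega)
      (fun i hi => by simp only [Set.mem_ofPred_eq]; omega) b' c').add_ones d).linearPath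
    refine (congrArg LinearPath ?_).mp this
    module
  · have h0 : PathOn (2 * y + 1) ((2 * y - 1) • {1} + {2 * x}) 0 (2 * y - 2 * x + 1)
        {q | q < 2 * y ∧ q ≠ 2 * y - 2 * x} := by
      refine ((route_up (Nat.zero_le (2 * y - 2 * x))).append
        (route_down (show 2 * y - 2 * x + 1 ≤ 2 * y by omega)) ?_).congr ?_ ?_ rfl rfl ?_
      · intro v; simp only [Set.mem_Icc]; omega
      · intro v; simp only [Set.mem_Icc, Set.mem_union, Set.mem_Iio]; omega
      · have h1 : 2 * y - 1 = (2 * y - 2 * x - 0) + (2 * y - (2 * y - 2 * x + 1)) := by omega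
        have h2 : gap (2 * y - 2 * x) (2 * y) = 2 * x := by unfold gap; omega
        rw [h1, h2]; module
      · rintro q ⟨h1, h2⟩
        simp only [Set.mem_Ico, Set.mem_union]; omega
    have := ((standard_of_aligned_pairs hx hy hxy.le (m := 1) h0 (by omega)
      (fun i hi => by simp only [Set.mem_ofPred_eq]; omega) b' c').add_ones d).linearPath
    refine (congrArg LinearPath ?_).mp this
    module
  -- The seed is `0, 2y, …, 2x + 1, 1, …, 2x`; it uses one 1 fewer than the others, so `d + 1` ones
  -- are appended below.
  · have h0 : PathOn (2 * y + 1) ((2 * y - 2) • {1} + {2 * x} + {2 * y}) 0 (2 * x)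
        {q | 1 ≤ q ∧ q < 2 * y ∧ q ≠ 2 * x} := by
      refine (((route_singleton 0).append
        (route_down (show 2 * x + 1 ≤ 2 * y by omega)) ?_).append
        (route_up (show 1 ≤ 2 * x by omega)) ?_).congr ?_ ?_ rfl rfl ?_
      · intro v; simp only [Set.mem_Icc, Set.mem_singleton_iff]; omega
      · intro v; simp only [Set.mem_Icc, Set.mem_singleton_iff, Set.mem_union]; omega
      · intro v
        simp only [Set.mem_Icc, Set.mem_singleton_iff, Set.mem_union, Set.mem_Iio]; omega
      · have h1 : 2 * y - 2 = (2 * y - (2 * x + 1)) + (2 * x - 1) := by omega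
        have h2 : gap 0 (2 * y) = 2 * y := by unfold gap; omega
        have h3 : gap (2 * x + 1) 1 = 2 * x := by unfold gap; omega
        rw [h1, h2, h3]; module
      · rintro q ⟨h1, h2, h3⟩
        simp only [Set.mem_Ico, Set.mem_union]; omega
    have := ((standard_of_aligned_pairs hx hy hxy.le (m := 1) h0 (by omega)
      (fun i hi => by simp only [Set.mem_ofPred_eq]; omega) b' c').add_ones (d + 1)).linearPath
    refine (congrArg LinearPath ?_).mp this
    have : 2 * y - 1 + d = 2 * y - 2 + (d + 1) := by omega
    rw [this]
    module

theorem linearPath_of_boundF {x y a b c : ℕ} (hx : 1 < x) (hxy : x < y) (ha : boundF x y ≤ a) :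
    LinearPath (a • {1} + b • {x} + c • {y}) := by
  unfold boundF at ha
  split_ifs at ha with h1 h2
  · obtain ⟨⟨x, rfl⟩, y, rfl⟩ := h1
    rw [← two_mul] at *
    rw [← two_mul] at *
    exact linearPath_of_both_even (by omega) (by omega) a b c ha
  · have h3 : x = 3 ∨ Even x := h2.imp_right And.left
    exact linearPath_of_standard hx hxy (standard_of_even_or_three hx h3) a b c (by omega)
      (by omega)
  · exact linearPath_of_standard hx hxy (standard_ones hx) a b c (by omega) (by omega)

/-! ### From lists to Hamiltonian paths -/

theorem exists_walk_of_nodup {v : ℕ} (t : List (Fin v)) (a : Fin v) (h : (a :: t).Nodup) :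
    ∃ (e : Fin v) (p : (⊤ : SimpleGraph (Fin v)).Walk a e), p.support = a :: t ∧
      ((p.edges.map edgeLinearLength : List ℕ) : Multiset ℕ) =
        gaps ((a :: t).map fun i : Fin v => (i : ℕ)) := by
  induction t generalizing a with
  | nil => exact ⟨a, .nil, by simp, by simp [gaps]⟩
  | cons b t ih =>
    obtain ⟨e, p, hp, hp'⟩ := ih b (List.nodup_cons.1 h).2
    have hab : (⊤ : SimpleGraph (Fin v)).Adj a b := by
      rw [SimpleGraph.top_adj]
      rintro rfl
      exact (List.nodup_cons.1 h).1 (by simp)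
    refine ⟨e, .cons hab p, by simp [hp], ?_⟩
    rw [SimpleGraph.Walk.edges_cons, List.map_cons, ← Multiset.cons_coe, hp']
    simp only [List.map_cons, gaps]
    congr 1
    change linearLength a b = _
    unfold linearLength gap
    omega

theorem LinearPath.linearlyRealizable {M : Multiset ℕ} (h : LinearPath M) {v : ℕ}
    (hv : v = M.card + 1) : LinearlyRealizable v M := by
  obtain ⟨n, s, e, l, h1, h2, h3, h4, -, -⟩ := h
  obtain ⟨w, rfl⟩ : ∃ w, l = s :: w := List.head?_eq_some_iff.1 h4
  have hlen : (s :: w).length = n := by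
    rw [← List.toFinset_card_of_nodup h1]
    have : (s :: w).toFinset = Finset.range n := by
      ext x
      rw [List.mem_toFinset, h2, Finset.mem_range, Set.mem_Iio]
    rw [this, Finset.card_range]
  have hn : v = n := by
    rw [hv, ← h3, card_gaps, ← hlen, List.length_cons]
  subst hn
  obtain ⟨l', hl'⟩ : ∃ l' : List (Fin v), l'.map (fun i : Fin v => (i : ℕ)) = s :: w :=
    ⟨(s :: w).pmap (fun a (ha : a < v) => ⟨a, ha⟩) fun a ha => Set.mem_Iio.1 ((h2 a).1 ha), by
      rw [List.map_pmap, List.pmap_eq_map, List.map_id']⟩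
  obtain ⟨a, t, rfl⟩ : ∃ a t, l' = a :: t := by
    cases l' with
    | nil => simp at hl'
    | cons a t => exact ⟨a, t, rfl⟩
  have hnd : (a :: t).Nodup := by
    rw [← hl'] at h1
    exact List.Nodup.of_map _ h1
  obtain ⟨e', p, hp, hp'⟩ := exists_walk_of_nodup t a hnd
  refine ⟨a, e', p, fun i => ?_, by rw [hp', hl', h3]⟩
  rw [hp]
  refine List.count_eq_one_of_mem hnd ?_
  have : (i : ℕ) ∈ s :: w := (h2 i).2 i.2
  rw [← hl', List.mem_map] at this
  obtain ⟨j, hj, hji⟩ := this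
  rwa [← Fin.ext hji]

theorem oneXY_eq (x y a b c : ℕ) : oneXY x y a b c = a • {1} + b • {x} + c • {y} := by
  simp [oneXY, Multiset.nsmul_singleton]

theorem card_oneXY (x y a b c : ℕ) : (oneXY x y a b c).card = a + b + c := by
  simp [oneXY]

theorem LinearlyRealizable.realizable {v : ℕ} {L : Multiset ℕ} (h : LinearlyRealizable v L)
    (hL : ∀ z ∈ L, z ≤ v / 2) : Realizable v L := by
  obtain ⟨s, t, p, hp, hpL⟩ := h
  refine ⟨s, t, p, hp, ?_⟩
  rw [← hpL]
  congr 1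
  refine List.map_congr_left fun e he => ?_
  have hle : edgeLinearLength e ≤ v / 2 := hL _ (by
    rw [← hpL, Multiset.mem_coe]
    exact List.mem_map_of_mem he)
  induction e with
  | h i j =>
    change linearLength i j ≤ v / 2 at hle
    change cyclicLength i j = linearLength i j
    unfold cyclicLength linearLength at *
    omega

/-! ### Lengths as residues up to sign, and dilations -/

theorem reducedForm_natCast {v m : ℕ} (hm : m < v) : reducedForm v (m : ZMod v) = min m (v - m) := by
  unfold reducedForm
  rw [ZMod.val_natCast_of_lt hm]

theorem reducedForm_le {v : ℕ} (g : ZMod v) : reducedForm v g ≤ v / 2 := by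
  unfold reducedForm; omega

section
variable {v : ℕ} [NeZero v]

theorem reducedForm_neg (g : ZMod v) : reducedForm v (-g) = reducedForm v g := by
  unfold reducedForm
  rw [ZMod.neg_val]
  have := ZMod.val_lt g
  split_ifs with h
  · simp [h]
  · omega

theorem natCast_reducedForm (g : ZMod v) :
    (reducedForm v g : ZMod v) = g ∨ (reducedForm v g : ZMod v) = -g := by
  unfold reducedForm
  rcases min_choice g.val (v - g.val) with h | h
  · left; rw [h, ZMod.natCast_zmod_val]
  · right
    rw [h, Nat.cast_sub (ZMod.val_lt g).le, ZMod.natCast_zmod_val, ZMod.natCast_self, zero_sub]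

theorem reducedForm_mul_natCast_reducedForm (u g : ZMod v) :
    reducedForm v (u * (reducedForm v g : ZMod v)) = reducedForm v (u * g) := by
  rcases natCast_reducedForm g with h | h
  · rw [h]
  · rw [h, mul_neg, reducedForm_neg]

theorem eq_or_eq_neg_of_reducedForm_eq {g g' : ZMod v} (h : reducedForm v g = reducedForm v g') :
    g = g' ∨ g = -g' := by
  have h1 := natCast_reducedForm g
  have h2 := natCast_reducedForm g'
  rw [h] at h1
  rcases h1 with h1 | h1 <;> rcases h2 with h2 | h2 <;> rw [h2] at h1
  · exact Or.inl h1.symm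
  · exact Or.inr h1.symm
  · exact Or.inr (by rw [h1, neg_neg])
  · exact Or.inl (neg_injective h1.symm)

theorem cyclicLength_eq_reducedForm (i j : Fin v) :
    cyclicLength i j = reducedForm v ((j : ℕ) - (i : ℕ) : ZMod v) := by
  rcases le_total (i : ℕ) (j : ℕ) with h | h
  · rw [← Nat.cast_sub h, reducedForm_natCast (by omega)]
    unfold cyclicLength; omega
  · rw [← reducedForm_neg, neg_sub, ← Nat.cast_sub h, reducedForm_natCast (by omega)]
    unfold cyclicLength; omega

/-- Multiplication by a unit modulo `v` on the vertices. -/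
def mulVertex (u : (ZMod v)ˣ) (i : Fin v) : Fin v := ⟨((u : ZMod v) * (i : ℕ)).val, ZMod.val_lt _⟩

theorem natCast_mulVertex (u : (ZMod v)ˣ) (i : Fin v) :
    ((mulVertex u i : ℕ) : ZMod v) = u * (i : ℕ) := ZMod.natCast_zmod_val _

theorem mulVertex_injective (u : (ZMod v)ˣ) : Function.Injective (mulVertex u) := by
  intro i j hij
  have h : (u : ZMod v) * (i : ℕ) = u * (j : ℕ) := by
    rw [← natCast_mulVertex, ← natCast_mulVertex, hij]
  have h := congrArg ZMod.val (u.isUnit.mul_left_cancel h)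
  rw [ZMod.val_natCast_of_lt i.2, ZMod.val_natCast_of_lt j.2] at h
  exact Fin.ext h

theorem cyclicLength_mulVertex (u : (ZMod v)ˣ) (i j : Fin v) :
    cyclicLength (mulVertex u i) (mulVertex u j) =
      reducedForm v (u * (cyclicLength i j : ZMod v)) := by
  rw [cyclicLength_eq_reducedForm, cyclicLength_eq_reducedForm i j,
    reducedForm_mul_natCast_reducedForm, natCast_mulVertex, natCast_mulVertex, mul_sub]

/-- Multiplication by a unit permutes the vertices and multiplies differences by `u`, up to sign. -/
theorem Realizable.map_mul {L : Multiset ℕ} (h : Realizable v L) (u : (ZMod v)ˣ) :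
    Realizable v (L.map fun z : ℕ => reducedForm v (u * (z : ZMod v))) := by
  obtain ⟨s, t, p, hp, rfl⟩ := h
  let f : (⊤ : SimpleGraph (Fin v)) →g (⊤ : SimpleGraph (Fin v)) :=
    ⟨mulVertex u, fun {i j} hij => by
      rw [SimpleGraph.top_adj] at hij ⊢
      exact fun h => hij (mulVertex_injective u h)⟩
  refine ⟨_, _, p.map f, hp.map f (Finite.injective_iff_bijective.1 (mulVertex_injective u)), ?_⟩
  rw [SimpleGraph.Walk.edges_map, Multiset.map_coe, List.map_map, List.map_map]
  congr 1
  refine List.map_congr_left fun e _ => ?_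
  induction e with
  | h i j => exact cyclicLength_mulVertex u i j

end

/-! ### The three bounds and the theorem -/

theorem realizable_of_boundF {v x y a b c : ℕ} (hx : 1 < x) (hxy : x < y) (hy : y ≤ v / 2)
    (hv : v = a + b + c + 1) (ha : boundF x y ≤ a) : Realizable v (oneXY x y a b c) := by
  have h := linearPath_of_boundF (b := b) (c := c) hx hxy ha
  rw [← oneXY_eq] at h
  refine (h.linearlyRealizable (by rw [card_oneXY, hv])).realizable fun z hz => ?_
  simp only [oneXY, Multiset.mem_add] at hz
  rcases hz with (hz | hz) | hz <;> rw [Multiset.eq_of_mem_replicate hz] <;> omega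

/-- The form of the bound in which the roles of the two lengths other than `1` are symmetric. -/
theorem realizable_of_boundF_min_max {v p q a b c : ℕ} (hp : 1 < p) (hq : 1 < q) (hpq : p ≠ q)
    (hpv : p ≤ v / 2) (hqv : q ≤ v / 2) (hv : v = a + b + c + 1)
    (ha : boundF (min p q) (max p q) ≤ a) : Realizable v (oneXY p q a b c) := by
  rcases lt_or_gt_of_ne hpq with h | h
  · rw [min_eq_left h.le, max_eq_right h.le] at ha
    exact realizable_of_boundF hp h hqv hv ha
  · rw [min_eq_right h.le, max_eq_left h.le] at ha
    have := realizable_of_boundF (b := c) (c := b) hq h hpv (by omega) ha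
    have e : oneXY p q a b c = oneXY q p a c b := by unfold oneXY; abel
    rwa [e]

theorem map_oneXY (f : ℕ → ℕ) (x y a b c : ℕ) : (oneXY x y a b c).map f =
    Multiset.replicate a (f 1) + Multiset.replicate b (f x) + Multiset.replicate c (f y) := by
  simp [oneXY]

section
variable {v x y : ℕ} [NeZero v]

theorem natCast_ne_and_ne_neg (hxy : x ≠ y) (hx : x ≤ v / 2) (hy : y ≤ v / 2) :
    ¬ ((x : ZMod v) = y ∨ (x : ZMod v) = -y) := by
  intro h
  have hv := NeZero.ne v
  have hr : reducedForm v (x : ZMod v) = reducedForm v (y : ZMod v) := by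
    rcases h with h | h
    · rw [h]
    · rw [h, reducedForm_neg]
  rw [reducedForm_natCast (by omega), reducedForm_natCast (by omega)] at hr
  omega

theorem one_lt_reducedForm {g : ZMod v} (h0 : g ≠ 0) (h1 : ¬ (g = 1 ∨ g = -1)) :
    1 < reducedForm v g := by
  by_contra hlt
  have hg := natCast_reducedForm g
  obtain h | h : reducedForm v g = 0 ∨ reducedForm v g = 1 := by omega
  · rw [h, Nat.cast_zero] at hg
    rcases hg with hg | hg
    · exact h0 hg.symm
    · exact h0 (neg_eq_zero.1 hg.symm)
  · rw [h, Nat.cast_one] at hg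
    rcases hg with hg | hg
    · exact h1 (Or.inl hg.symm)
    · exact h1 (Or.inr (by rw [hg, neg_neg]))

theorem Units.inv_mul_eq_or_eq_neg {R : Type*} [CommRing R] (u : Rˣ) (s t : R) :
    (((u⁻¹ : Rˣ) : R) * s = ((u⁻¹ : Rˣ) : R) * t ∨ ((u⁻¹ : Rˣ) : R) * s = -(((u⁻¹ : Rˣ) : R) * t)) ↔
      (s = t ∨ s = -t) := by
  rw [← mul_neg, u⁻¹.isUnit.mul_right_inj, u⁻¹.isUnit.mul_right_inj]

/-- A multiset `{r^a, p^b, q^c}` is realizable if `a` is large compared to the reduced forms of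
`p / r` and `q / r`. -/
theorem realizable_of_dilation {p q : ℕ} (u : (ZMod v)ˣ) {r : ℕ} (hu : (u : ZMod v) = r)
    (hr : r ≤ v / 2) (hp : p ≤ v / 2) (hq : q ≤ v / 2)
    (hp0 : (p : ZMod v) ≠ 0) (hq0 : (q : ZMod v) ≠ 0)
    (hpr : ¬ ((p : ZMod v) = r ∨ (p : ZMod v) = -r))
    (hqr : ¬ ((q : ZMod v) = r ∨ (q : ZMod v) = -r))
    (hpq : ¬ ((p : ZMod v) = q ∨ (p : ZMod v) = -q)) {a b c : ℕ} (hc : v = a + b + c + 1)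
    (ha : boundF
      (min (reducedForm v ((u⁻¹ : (ZMod v)ˣ) * (p : ZMod v)))
        (reducedForm v ((u⁻¹ : (ZMod v)ˣ) * (q : ZMod v))))
      (max (reducedForm v ((u⁻¹ : (ZMod v)ˣ) * (p : ZMod v)))
        (reducedForm v ((u⁻¹ : (ZMod v)ˣ) * (q : ZMod v)))) ≤ a) :
    Realizable v
      (Multiset.replicate a r + Multiset.replicate b p + Multiset.replicate c q) := by
  have h1 : ((u⁻¹ : (ZMod v)ˣ) : ZMod v) * r = 1 := by rw [← hu, Units.inv_mul]
  have hgt : ∀ s : ℕ, (s : ZMod v) ≠ 0 → ¬ ((s : ZMod v) = r ∨ (s : ZMod v) = -r) →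
      1 < reducedForm v ((u⁻¹ : (ZMod v)ˣ) * (s : ZMod v)) := by
    intro s hs hsr
    refine one_lt_reducedForm ?_ ?_
    · rwa [Ne, Units.mul_right_eq_zero]
    · rw [← h1, Units.inv_mul_eq_or_eq_neg]
      exact hsr
  have hne : reducedForm v ((u⁻¹ : (ZMod v)ˣ) * (p : ZMod v)) ≠
      reducedForm v ((u⁻¹ : (ZMod v)ˣ) * (q : ZMod v)) := by
    intro h
    have := eq_or_eq_neg_of_reducedForm_eq h
    rw [Units.inv_mul_eq_or_eq_neg] at this
    exact hpq this
  -- The bound is applied to the multiset divided by `r`, and the resulting path is multiplied back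
  -- by `u`.
  have key := (realizable_of_boundF_min_max (hgt p hp0 hpr) (hgt q hq0 hqr) hne
    (reducedForm_le _) (reducedForm_le _) hc ha).map_mul u
  have hred : ∀ s : ℕ, s ≤ v / 2 → reducedForm v (s : ZMod v) = s := by
    intro s hs
    rw [reducedForm_natCast (by omega)]; omega
  rw [map_oneXY] at key
  simp only [reducedForm_mul_natCast_reducedForm, Units.mul_inv_cancel_left] at key
  simpa only [Nat.cast_one, mul_one, hu, hred r hr, hred p hp, hred q hq] using key

end

theorem natCast_zmod_ne_zero {v m : ℕ} (h0 : 0 < m) (hm : m < v) : (m : ZMod v) ≠ 0 := by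
  rw [Ne, ZMod.natCast_eq_zero_iff]
  exact fun h => absurd (Nat.le_of_dvd h0 h) (by omega)

theorem realizable_of_boundF_dot {v x y a b c : ℕ} (hx : 1 < x) (hxy : x < y) (hy : y ≤ v / 2)
    (hvx : Nat.gcd v x = 1) (hv : v = a + b + c + 1)
    (hb : boundF (dotX v x y) (dotY v x y) ≤ b) : Realizable v (oneXY x y a b c) := by
  have : NeZero v := ⟨by omega⟩
  let u : (ZMod v)ˣ := ZMod.unitOfCoprime x (by rw [Nat.coprime_comm]; exact hvx)
  have hu : (u : ZMod v) = x := ZMod.coe_unitOfCoprime _ _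
  unfold dotX dotY at hb
  rw [← hu, ZMod.inv_coe_unit] at hb
  have key := realizable_of_dilation (p := y) (q := 1) u hu (by omega) hy (by omega)
    (natCast_zmod_ne_zero (by omega) (by omega)) (natCast_zmod_ne_zero (by omega) (by omega))
    (natCast_ne_and_ne_neg (by omega) (by omega) (by omega))
    (natCast_ne_and_ne_neg (by omega) (by omega) (by omega))
    (natCast_ne_and_ne_neg (by omega) (by omega) (by omega)) (a := b) (b := c) (c := a) (by omega)
    (by simpa only [Nat.cast_one, mul_one] using hb)
  have e : oneXY x y a b c =
      Multiset.replicate b x + Multiset.replicate c y + Multiset.replicate a 1 := by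
    unfold oneXY; abel
  rwa [e]

theorem realizable_of_boundF_ddot {v x y a b c : ℕ} (hx : 1 < x) (hxy : x < y) (hy : y ≤ v / 2)
    (hvy : Nat.gcd v y = 1) (hv : v = a + b + c + 1)
    (hc : boundF (ddotX v x y) (ddotY v x y) ≤ c) : Realizable v (oneXY x y a b c) := by
  have : NeZero v := ⟨by omega⟩
  let u : (ZMod v)ˣ := ZMod.unitOfCoprime y (by rw [Nat.coprime_comm]; exact hvy)
  have hu : (u : ZMod v) = y := ZMod.coe_unitOfCoprime _ _
  unfold ddotX ddotY at hc
  rw [← hu, ZMod.inv_coe_unit, mul_comm (x : ZMod v)] at hc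
  have key := realizable_of_dilation (p := 1) (q := x) u hu hy (by omega) (by omega)
    (natCast_zmod_ne_zero (by omega) (by omega)) (natCast_zmod_ne_zero (by omega) (by omega))
    (natCast_ne_and_ne_neg (by omega) (by omega) (by omega))
    (natCast_ne_and_ne_neg (by omega) (by omega) (by omega))
    (natCast_ne_and_ne_neg (by omega) (by omega) (by omega)) (a := c) (b := a) (c := b) (by omega)
    (by simpa only [Nat.cast_one, mul_one] using hc)
  have e : oneXY x y a b c =
      Multiset.replicate c y + Multiset.replicate a 1 + Multiset.replicate b x := by
    unfold oneXY; abel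
  rwa [e]

theorem theorem3 :
    (∀ v x y a b c : ℕ, 1 < x → x < y → y ≤ v / 2 → Nat.gcd v x = 1 → Nat.gcd v y = 1 →
      StronglyAdmissible v (oneXY x y a b c) →
        ((boundF x y ≤ a ∨ boundF (dotX v x y) (dotY v x y) ≤ b ∨
            boundF (ddotX v x y) (ddotY v x y) ≤ c) →
          Realizable v (oneXY x y a b c)) ∧
        (¬ Realizable v (oneXY x y a b c) →
          v + 2 ≤ boundF x y + boundF (dotX v x y) (dotY v x y)
            + boundF (ddotX v x y) (ddotY v x y))) ∧
    (∀ x y a b c : ℕ, 1 < x → x < y →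
      (x + y - 1 ≤ a → LinearlyRealizable (a + b + c + 1) (oneXY x y a b c)) ∧
      ((x = 3 ∨ Even x) → x + y - 2 ≤ a →
        LinearlyRealizable (a + b + c + 1) (oneXY x y a b c))) := by
  refine ⟨fun v x y a b c hx hxy hy hvx hvy hL => ?_,
    fun x y a b c hx hxy => ⟨fun ha => ?_, fun h ha => ?_⟩⟩
  · have hv : v = a + b + c + 1 := by
      rw [← hL.1.1, card_oneXY]
    have main : (boundF x y ≤ a ∨ boundF (dotX v x y) (dotY v x y) ≤ b ∨
        boundF (ddotX v x y) (ddotY v x y) ≤ c) → Realizable v (oneXY x y a b c) := by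
      rintro (h | h | h)
      · exact realizable_of_boundF hx hxy hy hv h
      · exact realizable_of_boundF_dot hx hxy hy hvx hv h
      · exact realizable_of_boundF_ddot hx hxy hy hvy hv h
    refine ⟨main, fun hn => ?_⟩
    -- Each multiplicity is at most its bound minus 1; summing the three, with `a + b + c = v - 1`,
    -- gives `v + 2`.
    have hn := mt main hn
    push Not at hn
    omega
  · have := linearPath_of_standard hx hxy (standard_ones hx) a b c (by omega) ha
    rw [← oneXY_eq] at this
    exact this.linearlyRealizable (by rw [card_oneXY])
  · have := linearPath_of_standard hx hxy (standard_of_even_or_three hx h) a b c (by omega)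
      (by omega)
    rw [← oneXY_eq] at this
    exact this.linearlyRealizable (by rw [card_oneXY])
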